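/- Let $N\ge 0$ be an integer, $0<\lambda\le\Lambda$ and $\kappa\in(0,1)$. For a real symmetric $N\times N$ matrix $A$ with eigenvalues $e_1,\dots,e_N$ (with multiplicity) let $$\mathcal M^-(A)=\lambda\sum_{e_i>0}e_i+\Lambda\sum_{e_i<0}e_i .$$ For $x_0\in\mathbb R^N$, $t_0\in\mathbb R$, $r>0$ put $Q_r(x_0,t_0)=B_r(x_0)\times(t_0-r^2,t_0]$, $\partial_pQ_r(x_0,t_0)=\big(B_r(x_0)\times\{t_0-r^2\}\big)\cup\big(\partial B_r(x_0)\times[t_0-r^2,t_0)\big)$, and $Q_1=Q_1(0,0)$. For a constant $\sigma$ and $Q=Q_r(x_0,t_0)$, the inequality $v_t-\mathcal M^-(D^2v)\ge\sigma$ in $Q$ is understood in the viscosity sense: $v$ is lower semicontinuous in $Q$, and whenever $p\in Q$, $\varphi$ is a $C^2$ function near $p$, and $v-\varphi$ has at $p$ a local minimum relative to $Q$, one has $\varphi_t(p)-\mathcal M^-(D^2\varphi(p))\ge\sigma$. There is a constant $C_k>0$, depending only on $\kappa,N,\lambda,\Lambda$, such that the following hold. (i) If $v$ is a real-valued function, lower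 semicontinuous on $Q_1\cup\partial_pQ_1$, with $v_t-\mathcal M^-(D^2v)\ge 1$ in $Q_1$ and $v\ge 0$ on $\partial_pQ_1$, then $v(x,0)\ge C_k$ for all $|x|\le\kappa$. (ii) If $x_0\in\mathbb R^N$, $t_0\in\mathbb R$, $r>0$, $\sigma\ge 0$, and $v$ is a real-valued function, lower semicontinuous on $Q_r(x_0,t_0)\cup\partial_pQ_r(x_0,t_0)$, with $v_t-\mathcal M^-(D^2v)\ge\sigma$ in $Q_r(x_0,t_0)$ and $v\ge 0$ on $\partial_pQ_r(x_0,t_0)$, then $v(x,t_0)\ge C_k\,\sigma\, r^2$ for all $|x-x_0|\le\kappa r$. -/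

import Mathlib

open Set

noncomputable section

/-- Points of space-time `ℝ^N × ℝ`, written `(x, t)`. -/
abbrev SpaceTime (N : ℕ) : Type := EuclideanSpace ℝ (Fin N) × ℝ

/-- The parabolic cylinder `Q_r(x₀, t₀) = B_r(x₀) × (t₀ - r², t₀]`. -/
def parabolicCylinder {N : ℕ} (r : ℝ) (x₀ : EuclideanSpace ℝ (Fin N)) (t₀ : ℝ) :
    Set (SpaceTime N) :=
  Metric.ball x₀ r ×ˢ Ioc (t₀ - r ^ 2) t₀

/-- The parabolic boundary
`∂_p Q_r(x₀, t₀) = (B_r(x₀) × {t₀ - r²}) ∪ (∂B_r(x₀) × [t₀ - r², t₀))`. -/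
def parabolicBoundary {N : ℕ} (r : ℝ) (x₀ : EuclideanSpace ℝ (Fin N)) (t₀ : ℝ) :
    Set (SpaceTime N) :=
  Metric.ball x₀ r ×ˢ {t₀ - r ^ 2} ∪ Metric.sphere x₀ r ×ˢ Ico (t₀ - r ^ 2) t₀

/-- Pucci's minimal operator `M⁻(A, lam, Lam) = lam ∑_{e_i > 0} e_i + Lam ∑_{e_i < 0} e_i`, where
the `e_i` are the eigenvalues of the symmetric matrix `A`, counted with multiplicity, that is, the
roots of its characteristic polynomial. -/
def pucciMinus {N : ℕ} (lam Lam : ℝ) (A : Matrix (Fin N) (Fin N) ℝ) : ℝ :=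
  lam * (A.charpoly.roots.filter (fun e => 0 < e)).sum +
    Lam * (A.charpoly.roots.filter (fun e => e < 0)).sum

/-- The time derivative `φ_t` at the space-time point `p`. -/
def timeDeriv {N : ℕ} (φ : SpaceTime N → ℝ) (p : SpaceTime N) : ℝ :=
  deriv (fun s => φ (p.1, s)) p.2

/-- The spatial Hessian `D²φ` at the space-time point `p`: the matrix of the second partial
derivatives of `φ` in the space variables. -/
def spaceHessian {N : ℕ} (φ : SpaceTime N → ℝ) (p : SpaceTime N) :
    Matrix (Fin N) (Fin N) ℝ :=
  Matrix.of fun i j =>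
    fderiv ℝ (fun y => fderiv ℝ (fun z => φ (z, p.2)) y (EuclideanSpace.single i 1)) p.1
      (EuclideanSpace.single j 1)

/-- The class of viscosity supersolutions of `v_t - M⁻(D²v) ≥ g` in `D`: `v` is lower
semicontinuous in `D`, and at every point `p` of `D` at which `v - φ` has a local minimum relative
to `D`, where `φ` is of class `C²` near `p`, one has `φ_t(p) - M⁻(D²φ(p)) ≥ g(p)`. -/
def IsPucciSupersolution {N : ℕ} (lam Lam : ℝ) (g : SpaceTime N → ℝ) (D : Set (SpaceTime N))
    (v : SpaceTime N → ℝ) : Prop :=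
  LowerSemicontinuousOn v D ∧
    ∀ p ∈ D, ∀ φ : SpaceTime N → ℝ, ContDiffAt ℝ 2 φ p →
      IsLocalMinOn (fun q => v q - φ q) D p →
        g p ≤ timeDeriv φ p - pucciMinus lam Lam (spaceHessian φ p)

end

/-!
The supersolution `v` is compared with the explicit function
`w(x, t) = k (t - t₀ + r²) (r² - |x - x₀|²)`, which vanishes on the parabolic boundary. Its Hessian
is the multiple `-2k (t - t₀ + r²)` of the identity, so `w_t - M⁻(D²w) ≤ k r² (1 + 2 Λ N)`, and
this is at most `σ` for `k = σ / (r² (1 + 2 Λ N))`. Hence `v ≥ w`, and at the final time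
`w(x, t₀) = k r² (r² - |x - x₀|²) ≥ σ r² (1 - κ²) / (1 + 2 Λ N)` for `|x - x₀| ≤ κ r`.

The edge `∂B × {t₀}` belongs neither to the cylinder nor to its parabolic boundary, and `v` may be
unbounded below near it, so the comparison is not made directly up to time `t₀`. It is made on the
cylinders ending at `T < t₀` (`IsPucciSupersolution.barrier_le_of_lt`), and the inequality is then
carried to `t₀` by the local fact that a supersolution cannot jump down at the final time
(`IsPucciSupersolution.le_at_final_time`). All test functions have the form
`α(t) - β(t) |x - c|²` with `β ≥ 0` (`IsPucciSupersolution.le_of_isLocalMinOn`).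
-/

open Topology

/-! ### Test functions with scalar Hessian -/

/-- On a nonpositive multiple of the identity all eigenvalues are nonpositive, so only the larger
ellipticity constant enters. -/
lemma pucciMinus_diagonal_neg {N : ℕ} (lam Lam m : ℝ) (hm : 0 ≤ m) :
    pucciMinus lam Lam (Matrix.diagonal fun _ : Fin N => -m) = -(Lam * (N * m)) := by
  have hroots : (Matrix.diagonal fun _ : Fin N => -m).charpoly.roots
      = Multiset.replicate N (-m) := by
    rw [Matrix.charpoly_diagonal]
    simp [Polynomial.roots_pow, Multiset.nsmul_singleton, -map_neg]
  rw [pucciMinus, hroots]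
  rcases hm.eq_or_lt with rfl | hm
  · simp [Multiset.filter_eq_nil.2, Multiset.mem_replicate]
  · rw [Multiset.filter_eq_nil.2, Multiset.filter_eq_self.2]
    · simp
    · intro a ha
      rw [Multiset.eq_of_mem_replicate ha]
      linarith
    · intro a ha
      rw [Multiset.eq_of_mem_replicate ha]
      linarith

lemma spaceHessian_sub_mul_norm_sq {N : ℕ} (α β : ℝ → ℝ) (c : EuclideanSpace ℝ (Fin N))
    (p : SpaceTime N) :
    spaceHessian (fun q : SpaceTime N => α q.2 - β q.2 * ‖q.1 - c‖ ^ 2) p =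
      Matrix.diagonal fun _ => -(2 * β p.2) := by
  have hgrad : ∀ y i, fderiv ℝ (fun z : EuclideanSpace ℝ (Fin N) =>
      α p.2 - β p.2 * ‖z - c‖ ^ 2) y (EuclideanSpace.single i 1) =
      -(2 * β p.2) * (y i - c i) := by
    intro y i
    have h := (((hasFDerivAt_id y).sub_const c).norm_sq.const_mul (β p.2)).const_sub (α p.2)
    rw [HasFDerivAt.fderiv (f := fun z : EuclideanSpace ℝ (Fin N) =>
      α p.2 - β p.2 * ‖z - c‖ ^ 2) h]
    simp [EuclideanSpace.inner_single_right]
    ring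
  ext i j
  simp only [spaceHessian, Matrix.of_apply, hgrad]
  have h : HasFDerivAt (fun y : EuclideanSpace ℝ (Fin N) => -(2 * β p.2) * (y i - c i))
      (-(2 * β p.2) • EuclideanSpace.proj (𝕜 := ℝ) i) p.1 :=
    ((EuclideanSpace.proj (𝕜 := ℝ) i).hasFDerivAt.sub_const (c i)).const_mul _
  rw [h.fderiv, Matrix.diagonal_apply]
  by_cases hij : i = j <;> simp [hij]

/-- The supersolution inequality tested with the functions `α(t) - β(t) |x - c|²`, `β ≥ 0`, whose
Hessian is a nonpositive multiple of the identity. -/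
lemma IsPucciSupersolution.le_of_isLocalMinOn {N : ℕ} {lam Lam : ℝ} {g : SpaceTime N → ℝ}
    {D : Set (SpaceTime N)} {v : SpaceTime N → ℝ} (hv : IsPucciSupersolution lam Lam g D v)
    {p : SpaceTime N} (hp : p ∈ D) {α β : ℝ → ℝ} {c : EuclideanSpace ℝ (Fin N)} {α' β' : ℝ}
    (hαC : ContDiffAt ℝ 2 α p.2) (hβC : ContDiffAt ℝ 2 β p.2)
    (hα : HasDerivAt α α' p.2) (hβ : HasDerivAt β β' p.2) (hβ0 : 0 ≤ β p.2)
    (hmin : IsLocalMinOn (fun q => v q - (α q.2 - β q.2 * ‖q.1 - c‖ ^ 2)) D p) :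
    g p ≤ α' - β' * ‖p.1 - c‖ ^ 2 + 2 * Lam * N * β p.2 := by
  have hC : ContDiffAt ℝ 2 (fun q : SpaceTime N => α q.2 - β q.2 * ‖q.1 - c‖ ^ 2) p :=
    (hαC.comp p contDiffAt_snd).sub
      ((hβC.comp p contDiffAt_snd).mul ((contDiffAt_fst.sub contDiffAt_const).norm_sq ℝ))
  have h := hv.2 p hp _ hC hmin
  have ht : timeDeriv (fun q : SpaceTime N => α q.2 - β q.2 * ‖q.1 - c‖ ^ 2) p =
      α' - β' * ‖p.1 - c‖ ^ 2 := by
    have hd := hα.sub (hβ.mul_const (‖p.1 - c‖ ^ 2))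
    exact hd.deriv
  rw [ht, spaceHessian_sub_mul_norm_sq, pucciMinus_diagonal_neg _ _ _ (by linarith)] at h
  linarith

/-! ### Comparison up to and at the final time -/

/-- A supersolution cannot jump down at the final time: a lower bound that holds near `x₁` at
earlier times persists at time `t₀`. A jump would let `v` be touched from below at time `t₀` by a
function decreasing in time as fast as desired. -/
lemma IsPucciSupersolution.le_at_final_time {N : ℕ} {lam Lam σ r t₀ : ℝ}
    {x₀ x₁ : EuclideanSpace ℝ (Fin N)} {v : SpaceTime N → ℝ} (hLam : 0 ≤ Lam) (hr : 0 < r)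
    (hv : IsPucciSupersolution lam Lam (fun _ => σ) (parabolicCylinder r x₀ t₀) v)
    {ρ δ₀ ℓ : ℝ} (hρ : 0 < ρ) (hδ₀ : 0 < δ₀)
    (hsub : Metric.closedBall x₁ ρ ⊆ Metric.ball x₀ r)
    (hℓ : ∀ x ∈ Metric.closedBall x₁ ρ, ∀ t ∈ Ioo (t₀ - δ₀) t₀, ℓ ≤ v (x, t)) :
    ℓ ≤ v (x₁, t₀) := by
  by_contra! hlt
  have hr2 : 0 < r ^ 2 := by positivity
  obtain ⟨m, hm⟩ : ∃ m, ∀ x ∈ Metric.closedBall x₁ ρ, m ≤ v (x, t₀) := by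
    have hK : IsCompact (Metric.closedBall x₁ ρ ×ˢ {t₀}) :=
      (isCompact_closedBall x₁ ρ).prod isCompact_singleton
    have hsubK : Metric.closedBall x₁ ρ ×ˢ {t₀} ⊆ parabolicCylinder r x₀ t₀ := by
      rintro ⟨x, t⟩ ⟨hx, rfl⟩
      exact ⟨hsub hx, by dsimp only; linarith, le_rfl⟩
    obtain ⟨m, hm⟩ := (hv.1.mono hsubK).bddBelow_of_isCompact hK
    exact ⟨m, fun x hx => hm ⟨(x, t₀), ⟨hx, rfl⟩, rfl⟩⟩
  -- `M` handles the lateral points at time `t₀`, then `K` violates the equation, then `δ` keeps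
  -- the earlier times above the value at `(x₁, t₀)`.
  set a := ℓ - v (x₁, t₀) with ha
  have ha0 : 0 < a := by linarith
  obtain ⟨M, hM0, hM⟩ : ∃ M, 0 ≤ M ∧ ℓ - m ≤ M * ρ ^ 2 :=
    ⟨|ℓ - m| / ρ ^ 2, by positivity, by
      rw [div_mul_cancel₀ _ (by positivity)]; exact le_abs_self _⟩
  obtain ⟨K, hK0, hK⟩ : ∃ K, 0 < K ∧ 2 * Lam * N * M - K < σ :=
    ⟨2 * Lam * N * M + |σ| + 1, by positivity, by linarith [neg_abs_le σ]⟩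
  obtain ⟨δ, hδ, hδ1, hδ2, hδ3⟩ : ∃ δ, 0 < δ ∧ δ < δ₀ ∧ δ < r ^ 2 ∧ K * δ < a := by
    obtain ⟨δ, h0, h⟩ := exists_between (show 0 < min δ₀ (min (r ^ 2) (a / K)) by positivity)
    rw [lt_min_iff, lt_min_iff, lt_div_iff₀ hK0] at h
    exact ⟨δ, h0, h.1, h.2.1, by linarith [h.2.2]⟩
  set F : SpaceTime N → ℝ := fun q => v q - ((ℓ - K * (q.2 - t₀)) - M * ‖q.1 - x₁‖ ^ 2) with hF
  set S : Set (SpaceTime N) := Metric.closedBall x₁ ρ ×ˢ Icc (t₀ - δ) t₀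
  have hSQ : S ⊆ parabolicCylinder r x₀ t₀ := by
    rintro ⟨x, t⟩ ⟨hx, ht⟩
    exact ⟨hsub hx, by dsimp only at *; linarith [ht.1], ht.2⟩
  have hmem : (x₁, t₀) ∈ S := ⟨Metric.mem_closedBall_self hρ.le, by simp [hδ.le]⟩
  have hFlsc : LowerSemicontinuousOn F S := by
    have hc : Continuous fun q : SpaceTime N =>
        -((ℓ - K * (q.2 - t₀)) - M * ‖q.1 - x₁‖ ^ 2) := by fun_prop
    simpa only [hF, sub_eq_add_neg] using
      (hv.1.mono hSQ).add (hc.lowerSemicontinuous.lowerSemicontinuousOn S)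
  obtain ⟨p, hpS, hp⟩ := hFlsc.exists_isMinOn ⟨_, hmem⟩
    ((isCompact_closedBall x₁ ρ).prod isCompact_Icc)
  have hFp : F p ≤ -a := by
    have h := hp hmem
    simp only [mem_ofPred_eq, hF, sub_self, norm_zero] at h ⊢
    linarith
  have hp2 : p.2 = t₀ := by
    by_contra hne
    have hlt' : p.2 < t₀ := lt_of_le_of_ne hpS.2.2 hne
    have h1 := hℓ p.1 hpS.1 p.2 ⟨by linarith [hpS.2.1], hlt'⟩
    have h2 : K * (t₀ - p.2) ≤ K * δ := by gcongr; linarith [hpS.2.1]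
    have h3 : 0 ≤ M * ‖p.1 - x₁‖ ^ 2 := by positivity
    simp only [hF] at hFp
    linarith
  have hp1 : ‖p.1 - x₁‖ < ρ := by
    refine lt_of_le_of_ne (by simpa [dist_eq_norm] using hpS.1) fun heq => ?_
    have h1 := hm p.1 hpS.1
    rw [← hp2] at h1
    simp only [hF, heq, hp2, sub_self] at hFp
    rw [hp2] at h1
    have h2 : v p = v (p.1, t₀) := by rw [← hp2]
    linarith
  have hmin : IsLocalMinOn F (parabolicCylinder r x₀ t₀) p := by
    have hU : Metric.ball x₁ ρ ×ˢ Ioi (t₀ - δ) ∈ 𝓝 p :=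
      (Metric.isOpen_ball.prod isOpen_Ioi).mem_nhds
        ⟨by simpa [dist_eq_norm] using hp1, by simp [hp2, hδ]⟩
    filter_upwards [mem_nhdsWithin_of_mem_nhds hU, self_mem_nhdsWithin] with q hqU hqQ
    exact hp ⟨Metric.ball_subset_closedBall hqU.1, le_of_lt hqU.2, hqQ.2.2⟩
  have hα : HasDerivAt (fun t => ℓ - K * (t - t₀)) (-K) p.2 := by
    simpa using (((hasDerivAt_id p.2).sub_const t₀).const_mul K).const_sub ℓ
  have key := hv.le_of_isLocalMinOn (hSQ hpS) (α := fun t => ℓ - K * (t - t₀))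
    (β := fun _ => M) (c := x₁) (by fun_prop) contDiffAt_const hα (hasDerivAt_const _ _) hM0 hmin
  linarith

/-- Comparison with the explicit subsolution `k (t - t₀ + r²) (r² - |x - x₀|²)` before the final
time. The set `Q ∪ ∂ₚQ` lacks the edge `∂B × {t₀}`, so minima are taken on the compact cylinders
ending at `T < t₀`, and the penalty `η / (T - t)` keeps them away from the time `T`. -/
lemma IsPucciSupersolution.barrier_le_of_lt {N : ℕ} {lam Lam σ k r t₀ : ℝ}
    {x₀ : EuclideanSpace ℝ (Fin N)} {v : SpaceTime N → ℝ} (hLam : 0 ≤ Lam)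
    (hk : 0 ≤ k) (hkσ : k * r ^ 2 * (1 + 2 * Lam * N) ≤ σ)
    (hlsc : LowerSemicontinuousOn v (parabolicCylinder r x₀ t₀ ∪ parabolicBoundary r x₀ t₀))
    (hv : IsPucciSupersolution lam Lam (fun _ => σ) (parabolicCylinder r x₀ t₀) v)
    (hb : ∀ p ∈ parabolicBoundary r x₀ t₀, 0 ≤ v p)
    {x₁ : EuclideanSpace ℝ (Fin N)} {t₁ : ℝ} (hx₁ : x₁ ∈ Metric.ball x₀ r)
    (ht₁ : t₁ ∈ Ioo (t₀ - r ^ 2) t₀) :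
    k * (t₁ - t₀ + r ^ 2) * (r ^ 2 - ‖x₁ - x₀‖ ^ 2) ≤ v (x₁, t₁) := by
  by_contra! hlt
  set w : SpaceTime N → ℝ :=
    fun q => k * (q.2 - t₀ + r ^ 2) * (r ^ 2 - ‖q.1 - x₀‖ ^ 2) with hw
  have hwc : Continuous w := by fun_prop
  obtain ⟨T, ht₁T, hT⟩ := exists_between ht₁.2
  have hcyl : ∀ τ < t₀, Metric.closedBall x₀ r ×ˢ Icc (t₀ - r ^ 2) τ ⊆
      parabolicCylinder r x₀ t₀ ∪ parabolicBoundary r x₀ t₀ := by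
    rintro τ hτ ⟨x, t⟩ ⟨hx, ht⟩
    dsimp only at hx ht
    have ht0 : t < t₀ := ht.2.trans_lt hτ
    rcases (Metric.mem_closedBall.1 hx).lt_or_eq with hx | hx
    · rcases ht.1.eq_or_lt with h | h
      · exact Or.inr (Or.inl ⟨hx, h.symm⟩)
      · exact Or.inl ⟨hx, h, ht0.le⟩
    · exact Or.inr (Or.inr ⟨hx, ht.1, ht0⟩)
  have hvw : LowerSemicontinuousOn (fun q => v q + -w q)
      (Metric.closedBall x₀ r ×ˢ Icc (t₀ - r ^ 2) T) :=
    (hlsc.mono (hcyl T hT)).add (hwc.neg.lowerSemicontinuous.lowerSemicontinuousOn _)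
  obtain ⟨m, hm⟩ := hvw.bddBelow_of_isCompact ((isCompact_closedBall x₀ r).prod isCompact_Icc)
  have ha : 0 < w (x₁, t₁) - v (x₁, t₁) := sub_pos.2 hlt
  have hTt : 0 < T - t₁ := sub_pos.2 ht₁T
  -- `η` is so small that `(x₁, t₁)` still violates the claim, and `δ` so small that the penalty
  -- exceeds `-m` at time `T - δ`.
  obtain ⟨η, hη0, hη⟩ : ∃ η, 0 < η ∧ η / (T - t₁) < w (x₁, t₁) - v (x₁, t₁) := by
    obtain ⟨η, h0, h⟩ := exists_between (mul_pos ha hTt)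
    exact ⟨η, h0, (div_lt_iff₀ hTt).2 h⟩
  obtain ⟨δ, hδ0, hδ1, hδ2⟩ : ∃ δ, 0 < δ ∧ δ < T - t₁ ∧ 0 < m + η / δ := by
    obtain ⟨δ, h0, h⟩ := exists_between (show 0 < min (T - t₁) (η / (|m| + 1)) by positivity)
    rw [lt_min_iff, lt_div_iff₀ (by positivity)] at h
    have h2 : |m| + 1 < η / δ := (lt_div_iff₀ h0).2 (by linarith [h.2])
    exact ⟨δ, h0, h.1, by linarith [neg_abs_le m]⟩
  set S : Set (SpaceTime N) := Metric.closedBall x₀ r ×ˢ Icc (t₀ - r ^ 2) (T - δ)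
  have hSsub : S ⊆ Metric.closedBall x₀ r ×ˢ Icc (t₀ - r ^ 2) T :=
    prod_mono_right (Icc_subset_Icc_right (by linarith))
  have hmem : (x₁, t₁) ∈ S :=
    ⟨Metric.ball_subset_closedBall hx₁, ht₁.1.le, by dsimp only; linarith⟩
  have hFlsc : LowerSemicontinuousOn (fun q => (v q + -w q) + η / (T - q.2)) S := by
    have hc : ContinuousOn (fun q : SpaceTime N => η / (T - q.2)) S := by
      refine continuousOn_const.div (by fun_prop) fun q hq => ?_
      have := hq.2.2
      exact ne_of_gt (by linarith)
    exact (hvw.mono hSsub).add hc.lowerSemicontinuousOn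
  obtain ⟨p, hpS, hp⟩ := hFlsc.exists_isMinOn ⟨_, hmem⟩
    ((isCompact_closedBall x₀ r).prod isCompact_Icc)
  have hFp : (v p + -w p) + η / (T - p.2) < 0 := by
    have h := hp hmem
    simp only [mem_ofPred_eq] at h
    linarith
  have hTp : 0 < T - p.2 := by linarith [hpS.2.2]
  have hvp : v p < w p := by
    have : 0 < η / (T - p.2) := by positivity
    linarith
  have hp2 : p.2 < T - δ := by
    refine lt_of_le_of_ne hpS.2.2 fun heq => ?_
    have h1 : m ≤ v p + -w p := hm ⟨p, hSsub hpS, rfl⟩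
    rw [heq, sub_sub_cancel] at hFp
    linarith
  have hpQ : p ∈ parabolicCylinder r x₀ t₀ := by
    refine (hcyl T hT (hSsub hpS)).resolve_right fun hpb => ?_
    have h1 := hb p hpb
    have h2 : w p = 0 := by
      rcases hpb with ⟨-, h⟩ | ⟨h, -⟩
      · rw [mem_singleton_iff] at h
        simp [hw, h]
      · rw [mem_sphere_iff_norm] at h
        simp [hw, h]
    linarith
  have hmin : IsLocalMinOn (fun q => v q - ((k * (q.2 - t₀ + r ^ 2) * r ^ 2 - η / (T - q.2)) -
      k * (q.2 - t₀ + r ^ 2) * ‖q.1 - x₀‖ ^ 2)) (parabolicCylinder r x₀ t₀) p := by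
    have hU : (univ : Set (EuclideanSpace ℝ (Fin N))) ×ˢ Iio (T - δ) ∈ 𝓝 p :=
      (isOpen_univ.prod isOpen_Iio).mem_nhds ⟨mem_univ _, hp2⟩
    filter_upwards [mem_nhdsWithin_of_mem_nhds hU, self_mem_nhdsWithin] with q hqU hqQ
    have h : (v p + -w p) + η / (T - p.2) ≤ (v q + -w q) + η / (T - q.2) :=
      hp ⟨Metric.ball_subset_closedBall hqQ.1, hqQ.2.1.le, le_of_lt hqU.2⟩
    simp only [hw] at h
    linarith
  have hα : HasDerivAt (fun t => k * (t - t₀ + r ^ 2) * r ^ 2 - η / (T - t))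
      (k * r ^ 2 - η / (T - p.2) ^ 2) p.2 := by
    have h1 := ((((hasDerivAt_id p.2).sub_const t₀).add_const (r ^ 2)).const_mul k).mul_const
      (r ^ 2)
    have h2 := (hasDerivAt_const p.2 η).div ((hasDerivAt_id p.2).const_sub T) hTp.ne'
    refine (h1.sub h2).congr_deriv ?_
    simp only [id_eq]
    ring
  have hβ : HasDerivAt (fun t => k * (t - t₀ + r ^ 2)) k p.2 := by
    simpa using (((hasDerivAt_id p.2).sub_const t₀).add_const (r ^ 2)).const_mul k
  have hp0 : 0 ≤ p.2 - t₀ + r ^ 2 := by linarith [hpS.2.1]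
  have hαC : ContDiffAt ℝ 2 (fun t => k * (t - t₀ + r ^ 2) * r ^ 2 - η / (T - t)) p.2 :=
    ContDiffAt.sub (by fun_prop) (contDiffAt_const.div (by fun_prop) hTp.ne')
  have key := hv.le_of_isLocalMinOn hpQ (β := fun t => k * (t - t₀ + r ^ 2)) (c := x₀)
    hαC (by fun_prop) hα hβ (mul_nonneg hk hp0) hmin
  have h1 : 0 < η / (T - p.2) ^ 2 := by positivity
  have h2 : 0 ≤ k * ‖p.1 - x₀‖ ^ 2 := by positivity
  have h3 : 2 * Lam * N * (k * (p.2 - t₀ + r ^ 2)) ≤ 2 * Lam * N * (k * r ^ 2) := by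
    gcongr
    linarith [hpQ.2.2]
  linarith

lemma IsPucciSupersolution.barrier_le_at_final_time {N : ℕ} {lam Lam σ k r t₀ : ℝ}
    {x₀ : EuclideanSpace ℝ (Fin N)} {v : SpaceTime N → ℝ} (hLam : 0 ≤ Lam) (hr : 0 < r)
    (hk : 0 ≤ k) (hkσ : k * r ^ 2 * (1 + 2 * Lam * N) ≤ σ)
    (hlsc : LowerSemicontinuousOn v (parabolicCylinder r x₀ t₀ ∪ parabolicBoundary r x₀ t₀))
    (hv : IsPucciSupersolution lam Lam (fun _ => σ) (parabolicCylinder r x₀ t₀) v)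
    (hb : ∀ p ∈ parabolicBoundary r x₀ t₀, 0 ≤ v p)
    {x₁ : EuclideanSpace ℝ (Fin N)} (hx₁ : x₁ ∈ Metric.ball x₀ r) :
    k * r ^ 2 * (r ^ 2 - ‖x₁ - x₀‖ ^ 2) ≤ v (x₁, t₀) := by
  refine le_of_forall_lt fun ℓ hℓ => ?_
  obtain ⟨ℓ', hℓℓ', hℓ'⟩ := exists_between hℓ
  refine hℓℓ'.trans_le ?_
  have hwc : Continuous fun q : SpaceTime N =>
      k * (q.2 - t₀ + r ^ 2) * (r ^ 2 - ‖q.1 - x₀‖ ^ 2) := by fun_prop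
  have hU : {q : SpaceTime N | q.1 ∈ Metric.ball x₀ r ∧ t₀ - r ^ 2 < q.2 ∧
      ℓ' < k * (q.2 - t₀ + r ^ 2) * (r ^ 2 - ‖q.1 - x₀‖ ^ 2)} ∈ 𝓝 (x₁, t₀) := by
    refine IsOpen.mem_nhds ?_ ⟨hx₁, by simpa using pow_pos hr 2, by simpa using hℓ'⟩
    exact (Metric.isOpen_ball.preimage continuous_fst).inter
      ((isOpen_lt continuous_const continuous_snd).inter (isOpen_lt continuous_const hwc))
  obtain ⟨ε, hε, hεU⟩ := Metric.nhds_basis_closedBall.mem_iff.1 hU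
  rw [← closedBall_prod_same] at hεU
  refine hv.le_at_final_time hLam hr (ρ := ε) (δ₀ := ε) hε hε (fun x hx => ?_)
    fun x hx t ht => ?_
  · exact (hεU (show (x, t₀) ∈ _ from ⟨hx, Metric.mem_closedBall_self hε.le⟩)).1
  · obtain ⟨h1, h2, h3⟩ := hεU (show (x, t) ∈ _ from ⟨hx, by
      rw [Real.closedBall_eq_Icc]; exact ⟨ht.1.le, by linarith [ht.2]⟩⟩)
    exact h3.le.trans (hv.barrier_le_of_lt hLam hk hkσ hlsc hb h1 ⟨h2, ht.2⟩)

/-! ### The quantitative lower bound -/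

theorem mainTheorem7 (N : ℕ) (lam Lam κ : ℝ) (hlam : 0 < lam) (hLam : lam ≤ Lam)
    (hκ0 : 0 < κ) (hκ1 : κ < 1) :
    ∃ C : ℝ, 0 < C ∧
      (∀ v : SpaceTime N → ℝ,
        LowerSemicontinuousOn v (parabolicCylinder 1 0 0 ∪ parabolicBoundary 1 0 0) →
        IsPucciSupersolution lam Lam (fun _ => 1) (parabolicCylinder 1 0 0) v →
        (∀ p ∈ parabolicBoundary (N := N) 1 0 0, 0 ≤ v p) →
        ∀ x : EuclideanSpace ℝ (Fin N), ‖x‖ ≤ κ → C ≤ v (x, 0)) ∧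
      (∀ (x₀ : EuclideanSpace ℝ (Fin N)) (t₀ r σ : ℝ), 0 < r → 0 ≤ σ →
        ∀ v : SpaceTime N → ℝ,
        LowerSemicontinuousOn v (parabolicCylinder r x₀ t₀ ∪ parabolicBoundary r x₀ t₀) →
        IsPucciSupersolution lam Lam (fun _ => σ) (parabolicCylinder r x₀ t₀) v →
        (∀ p ∈ parabolicBoundary r x₀ t₀, 0 ≤ v p) →
        ∀ x : EuclideanSpace ℝ (Fin N), ‖x - x₀‖ ≤ κ * r → C * σ * r ^ 2 ≤ v (x, t₀)) := by
  have hLam0 : 0 ≤ Lam := (hlam.trans_le hLam).le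
  have hD : 0 < 1 + 2 * Lam * N := by positivity
  have hκ2 : 0 < 1 - κ ^ 2 := by nlinarith
  have main : ∀ (x₀ : EuclideanSpace ℝ (Fin N)) (t₀ r σ : ℝ), 0 < r → 0 ≤ σ →
      ∀ v : SpaceTime N → ℝ,
      LowerSemicontinuousOn v (parabolicCylinder r x₀ t₀ ∪ parabolicBoundary r x₀ t₀) →
      IsPucciSupersolution lam Lam (fun _ => σ) (parabolicCylinder r x₀ t₀) v →
      (∀ p ∈ parabolicBoundary r x₀ t₀, 0 ≤ v p) →
      ∀ x : EuclideanSpace ℝ (Fin N), ‖x - x₀‖ ≤ κ * r →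
        (1 - κ ^ 2) / (1 + 2 * Lam * N) * σ * r ^ 2 ≤ v (x, t₀) := by
    intro x₀ t₀ r σ hr hσ v hlsc hv hb x hx
    have hxball : x ∈ Metric.ball x₀ r := by
      rw [mem_ball_iff_norm]
      exact hx.trans_lt (mul_lt_of_lt_one_left hr hκ1)
    have hkσ : σ / (r ^ 2 * (1 + 2 * Lam * N)) * r ^ 2 * (1 + 2 * Lam * N) = σ := by
      field_simp
    refine le_trans ?_ (hv.barrier_le_at_final_time hLam0 hr
      (k := σ / (r ^ 2 * (1 + 2 * Lam * N))) (by positivity) hkσ.le hlsc hb hxball)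
    calc (1 - κ ^ 2) / (1 + 2 * Lam * N) * σ * r ^ 2
        = σ / (r ^ 2 * (1 + 2 * Lam * N)) * r ^ 2 * (r ^ 2 - (κ * r) ^ 2) := by
          field_simp
      _ ≤ _ := by gcongr
  refine ⟨(1 - κ ^ 2) / (1 + 2 * Lam * N), by positivity, fun v hlsc hv hb x hx => ?_, main⟩
  simpa using main 0 0 1 1 one_pos zero_le_one v hlsc hv hb x (by simpa using hx)
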